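/- Let $(R,\mathfrak m)$ be a Noetherian local domain of Krull dimension one with field of fractions $Q(R)$, and assume that $R$ is analytically irreducible, that is, the integral closure $\overline R$ of $R$ in $Q(R)$ is a discrete valuation ring and a finitely generated $R$-module. Let $\mathfrak n$ be the maximal ideal of $\overline R$ and $v$ the normalized discrete valuation of $\overline R$. Assume that the canonical map $R/\mathfrak m\to\overline R/\mathfrak n$ is an isomorphism, that $R/\mathfrak m$ is infinite, and that $R$ is Gorenstein (i.e. $R$ has finite injective dimension as a module over itself). Let $H=v(R)=\{v(r) : r\in R\setminus\{0\}\}$ be the value semigroup of $R$. For a finitely generated $R$-module $M$ put $\operatorname{tr}(M)=\sum_{\varphi\in\operatorname{Hom}_R(M,R)}\varphi(M)$; an ideal $I$ of $R$ is called a trace ideal if $I=\operatorname{tr}(M)$ for some finitely generated $R$-module $M$. Write $\langle A\rangle$ for the additive submonoid of $\mathbb Z_{\ge 0}$ generated by $A$. Then the following conditions are equivalent: (i) $R$ has only finitely many trace ideals; (ii) $H=\langle 1\rangle$, or $H=\langle 2,a\rangle$ for some odd number $a>2$, or $H=\langle 3,4\rangle$, or $H=\langle 3,5\rangle$; (iii)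 every trace ideal $I$ of $R$ is integrally closed, i.e. every $x\in R$ satisfying an equation $x^n+a_1x^{n-1}+\cdots+a_n=0$ with $n\ge 1$ and $a_i\in I^i$ for $1\le i\le n$ belongs to $I$. -/

import Mathlib

namespace TraceIdeals

universe u v

/-- The trace of an `R`-module `M`: the sum of the ideals `φ(M)` over all `R`-linear `φ : M → R`. -/
def moduleTrace (R : Type u) [CommRing R] (M : Type v) [AddCommGroup M] [Module R M] : Ideal R :=
  ⨆ φ : M →ₗ[R] R, LinearMap.range φ

/-- `I` is a trace ideal if it is the trace of a finitely generated `R`-module. (Every finitely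
generated `R`-module is isomorphic to one in the universe of `R`.) -/
def IsTraceIdeal {R : Type u} [CommRing R] (I : Ideal R) : Prop :=
  ∃ (M : Type u) (_ : AddCommGroup M) (_ : Module R M),
    Module.Finite R M ∧ I = moduleTrace R M

/-- `x` is integral over the ideal `I`: it satisfies an equation
`x ^ n + a₁ x ^ (n - 1) + ⋯ + aₙ = 0` with `n ≥ 1` and `aᵢ ∈ I ^ i`. -/
def IsIntegralOverIdeal {R : Type u} [CommRing R] (I : Ideal R) (x : R) : Prop :=
  ∃ (n : ℕ) (a : ℕ → R), 0 < n ∧ (∀ i ∈ Finset.Icc 1 n, a i ∈ I ^ i) ∧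
    x ^ n + ∑ i ∈ Finset.Icc 1 n, a i * x ^ (n - i) = 0

/-- `I` is integrally closed (as an ideal): it contains every element of `R` integral over it. -/
def IsIntegrallyClosedIdeal {R : Type u} [CommRing R] (I : Ideal R) : Prop :=
  ∀ x : R, IsIntegralOverIdeal I x → x ∈ I

/-- A local ring is Gorenstein if it is Noetherian and has finite injective dimension as a module
over itself. -/
def IsGorensteinLocalRing (R : Type u) [CommRing R] [IsLocalRing R] : Prop :=
  IsNoetherianRing R ∧
    ∃ n : ℕ, CategoryTheory.HasInjectiveDimensionLE (ModuleCat.of R R) n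

/-- The value semigroup `{v(r) | r ∈ R, r ≠ 0}` of a domain `R` with respect to the normalized
valuation `v` of a discrete valuation ring `S ⊇ R`. -/
noncomputable def valueSemigroup (R : Type u) [CommRing R] [IsDomain R]
    (S : Type v) [CommRing S] [IsDomain S] [IsDiscreteValuationRing S] [Algebra R S] :
    AddSubmonoid ℕ where
  carrier := {n | ∃ r : R, r ≠ 0 ∧ IsDiscreteValuationRing.addVal S (algebraMap R S r) = n}
  zero_mem' := ⟨1, one_ne_zero, by simp⟩
  add_mem' := by
    rintro m n ⟨r, hr, hm⟩ ⟨s, hs, hn⟩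
    exact ⟨r * s, mul_ne_zero hr hs, by
      rw [map_mul, IsDiscreteValuationRing.addVal_mul, hm, hn, Nat.cast_add]⟩

end TraceIdeals

/-! Write `B` for the integral closure and `c` for a bound such that every element of `B` of value
at least `c` lies in `R`.

(i) ⇒ (ii). Finite injective dimension gives `Ext ^ 2 (R / I, R) = 0` for all `I`, and from this the
duality `N ↦ R : N` separates nested `R`-submodules of `B` that contain `1` (`le_of_dualIdeal_le`).
For a ring `S` between `R` and `B` the ideal `R : S` is a trace ideal, so infinitely many such rings
give infinitely many trace ideals. If `p ≥ 2` and `p, p + 1` are both gaps of `H`, the rings `R + R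
(t + l t') + {v ≥ p + 2}` with `v t = p`, `v t' = p + 1` differ for different residue classes of `l`
(`infinite_isTraceIdeal`). So `H` has no such gaps. Duality also yields half of the symmetry of `H`
(`mem_valueSemigroup_of_isGorenstein`), and the two conditions leave only the listed semigroups
(`classification_of_gaps`).

(ii) ⇒ (iii). A nonzero trace ideal `I` contains every element of value at least `c`. Let `m` be its
least value, attained at `x`. For the listed semigroups at most one value `q` in `H ∩ [m, c)` is
outside `m + H`. If `I` attains all values in `H ∩ [m, c)`, it is `{v ≥ m} ∩ R`, which is integrally
closed. Otherwise `I ⊆ x R + {v ≥ c}`; then a `z` of value `q` satisfies `z I ⊆ x R`, which forces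
`z ∈ I`, a contradiction.

(iii) ⇒ (i). An integrally closed nonzero ideal is determined by its least value, and for a trace
ideal this is at most `c`. -/

namespace TraceIdeals

universe u v

open CategoryTheory CategoryTheory.Abelian IsLocalRing

/-! ### Long exact sequences for `Ext (-, R)`. -/

section Ext

variable (R : Type u) [CommRing R]

/-- Vanishing of `Ext ^ n (M, R)`. -/
def ExtVanishes (M : Type u) [AddCommGroup M] [Module R M] (n : ℕ) : Prop :=
  Subsingleton (Ext.{u} (ModuleCat.of R M) (ModuleCat.of R R) n)

variable {R} {A B C : Type u} [AddCommGroup A] [Module R A] [AddCommGroup B] [Module R B]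
  [AddCommGroup C] [Module R C]

theorem extVanishes_of_projective (M : Type u) [AddCommGroup M] [Module R M] [Module.Projective R M]
    (n : ℕ) : ExtVanishes R M (n + 1) := by
  have : Projective (ModuleCat.of R M) := inferInstance
  exact Ext.subsingleton_of_projective _ _ _

theorem ExtVanishes.of_hasInjectiveDimensionLE {d : ℕ}
    (h : HasInjectiveDimensionLE (ModuleCat.of R R) d) (M : Type u) [AddCommGroup M] [Module R M]
    {n : ℕ} (hn : d + 1 ≤ n) : ExtVanishes R M n :=
  HasInjectiveDimensionLT.subsingleton _ (d + 1) n hn _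

variable {f : A →ₗ[R] B} {g : B →ₗ[R] C}

theorem shortExact_of_linearMap (hf : Function.Injective f) (hg : Function.Surjective g)
    (hfg : Function.Exact f g) :
    (ShortComplex.mk (ModuleCat.ofHom f) (ModuleCat.ofHom g)
      (by ext x; exact hfg.apply_apply_eq_zero x)).ShortExact where
  exact := (ShortComplex.ShortExact.moduleCat_exact_iff_function_exact _).2 hfg
  mono_f := (ModuleCat.mono_iff_injective _).2 hf
  epi_g := (ModuleCat.epi_iff_surjective _).2 hg

theorem ExtVanishes.of_ends (hf : Function.Injective f) (hg : Function.Surjective g)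
    (hfg : Function.Exact f g) {n : ℕ} (hA : ExtVanishes R A n) (hC : ExtVanishes R C n) :
    ExtVanishes R B n := by
  refine subsingleton_of_forall_eq 0 fun x => ?_
  obtain ⟨y, rfl⟩ := Ext.contravariant_sequence_exact₂ (shortExact_of_linearMap hf hg hfg) _ x
    (hA.elim _ _)
  rw [hC.elim y 0, Ext.comp_zero]

theorem ExtVanishes.of_sub (hf : Function.Injective f) (hg : Function.Surjective g)
    (hfg : Function.Exact f g) {n : ℕ} (hB : ExtVanishes R B n) (hC : ExtVanishes R C (n + 1)) :
    ExtVanishes R A n := by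
  refine subsingleton_of_forall_eq 0 fun x => ?_
  obtain ⟨y, rfl⟩ := Ext.contravariant_sequence_exact₁ (shortExact_of_linearMap hf hg hfg) _ x
    (add_comm 1 n) (hC.elim _ _)
  rw [hB.elim y 0, Ext.comp_zero]

theorem ExtVanishes.of_quotient (hf : Function.Injective f) (hg : Function.Surjective g)
    (hfg : Function.Exact f g) {n : ℕ} (hA : ExtVanishes R A n) (hB : ExtVanishes R B (n + 1)) :
    ExtVanishes R C (n + 1) := by
  refine subsingleton_of_forall_eq 0 fun x => ?_
  obtain ⟨y, rfl⟩ := Ext.contravariant_sequence_exact₃ (shortExact_of_linearMap hf hg hfg) _ x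
    (hB.elim _ _) (add_comm 1 n)
  rw [hA.elim y 0, Ext.comp_zero]

theorem ExtVanishes.of_bijective (hf : Function.Bijective f) {n : ℕ} (hB : ExtVanishes R B n) :
    ExtVanishes R A n :=
  hB.of_sub (C := PUnit.{u + 1}) (g := 0) hf.1 (fun _ => ⟨0, Subsingleton.elim _ _⟩)
    (fun y => ⟨fun _ => hf.2 y, fun _ => Subsingleton.elim _ _⟩) (extVanishes_of_projective _ n)

theorem ExtVanishes.exists_extension (hf : Function.Injective f) (hg : Function.Surjective g)
    (hfg : Function.Exact f g) (hC : ExtVanishes R C 1) (φ : A →ₗ[R] R) :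
    ∃ ψ : B →ₗ[R] R, ψ ∘ₗ f = φ := by
  obtain ⟨y, hy⟩ := Ext.contravariant_sequence_exact₁ (shortExact_of_linearMap hf hg hfg) _
    (Ext.mk₀ (ModuleCat.ofHom φ)) (add_zero 1) (hC.elim _ _)
  obtain ⟨ψ, rfl⟩ := Ext.homEquiv₀.symm.surjective y
  refine ⟨ψ.hom, ?_⟩
  have : ModuleCat.ofHom f ≫ ψ = ModuleCat.ofHom φ :=
    Ext.homEquiv₀.symm.injective (by simpa using hy)
  ext x
  exact congrArg (fun h => h.hom x) this

theorem ExtVanishes.of_forall_extension (hf : Function.Injective f) (hg : Function.Surjective g)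
    (hfg : Function.Exact f g) (hB : ExtVanishes R B 1)
    (h : ∀ φ : A →ₗ[R] R, ∃ ψ : B →ₗ[R] R, ψ ∘ₗ f = φ) : ExtVanishes R C 1 := by
  refine subsingleton_of_forall_eq 0 fun x => ?_
  have hS := shortExact_of_linearMap hf hg hfg
  obtain ⟨y, rfl⟩ := Ext.contravariant_sequence_exact₃ hS _ x (hB.elim _ _) (add_zero 1)
  obtain ⟨φ, rfl⟩ := Ext.homEquiv₀.symm.surjective y
  obtain ⟨ψ, hψ⟩ := h φ.hom
  have : φ = ModuleCat.ofHom f ≫ ModuleCat.ofHom ψ := by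
    ext x
    exact (congrArg (fun h => h x) hψ).symm
  rw [this, Ext.homEquiv₀_symm_apply, ← Ext.mk₀_comp_mk₀]
  exact hS.extClass_comp_assoc _

end Ext

/-! ### Dévissage of `R / J` by copies of the residue field. -/

section Residue

variable {R : Type u} [CommRing R] [IsLocalRing R]

/-- Multiplication by `z` as a map `R / m → N`, where `m z = 0`. -/
def residueMulHom {N : Type*} [AddCommGroup N] [Module R N] (z : N)
    (hz : ∀ a ∈ maximalIdeal R, a • z = 0) : (R ⧸ maximalIdeal R) →ₗ[R] N :=
  (maximalIdeal R).liftQ (LinearMap.toSpanSingleton R N z) fun a ha => hz a ha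

theorem residueMulHom_mk {N : Type*} [AddCommGroup N] [Module R N] (z : N)
    (hz : ∀ a ∈ maximalIdeal R, a • z = 0) (r : R) :
    residueMulHom z hz (Ideal.Quotient.mk _ r) = r • z := rfl

theorem residueMulHom_injective {N : Type*} [AddCommGroup N] [Module R N] {z : N}
    (hz : ∀ a ∈ maximalIdeal R, a • z = 0) (hz0 : z ≠ 0) :
    Function.Injective (residueMulHom z hz) := by
  rw [injective_iff_map_eq_zero]
  intro x hx
  obtain ⟨r, rfl⟩ := Ideal.Quotient.mk_surjective x
  rw [residueMulHom_mk] at hx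
  rw [Ideal.Quotient.eq_zero_iff_mem]
  by_contra hr
  have hu : IsUnit r := by simpa using hr
  exact hz0 ((hu.smul_eq_zero).1 hx)

/-- When moreover `z ∉ J`, the left map is injective, so one copy of the residue field is split off
from `R / J`. -/
theorem exact_residueMulHom_factor {J : Ideal R} {z : R} (hz : ∀ a ∈ maximalIdeal R, a * z ∈ J) :
    Function.Exact
      (residueMulHom (J.mkQ z) fun a ha => by
        rw [← map_smul, Submodule.mkQ_apply, Submodule.Quotient.mk_eq_zero]; exact hz a ha)
      (Submodule.mapQ J (J ⊔ Ideal.span {z}) LinearMap.id le_sup_left) := by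
  intro y
  obtain ⟨y, rfl⟩ := Ideal.Quotient.mk_surjective y
  have : Submodule.mapQ J (J ⊔ Ideal.span {z}) LinearMap.id le_sup_left (Ideal.Quotient.mk J y) =
    Ideal.Quotient.mk (J ⊔ Ideal.span {z}) y := rfl
  rw [this, Ideal.Quotient.eq_zero_iff_mem]
  constructor
  · intro h
    obtain ⟨j, hj, w, hw, rfl⟩ := Submodule.mem_sup.1 h
    obtain ⟨r, rfl⟩ := Ideal.mem_span_singleton'.1 hw
    refine ⟨Ideal.Quotient.mk _ r, ?_⟩
    rw [residueMulHom_mk, map_add, Ideal.Quotient.eq_zero_iff_mem.2 hj, zero_add]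
    rfl
  · rintro ⟨x, hx⟩
    obtain ⟨r, rfl⟩ := Ideal.Quotient.mk_surjective x
    rw [residueMulHom_mk] at hx
    have : r * z - y ∈ J := Ideal.Quotient.eq.1 hx
    have h2 : y = r * z - (r * z - y) := by ring
    rw [h2]
    exact sub_mem (Ideal.mem_sup_right (Ideal.mul_mem_left _ _ (Ideal.mem_span_singleton_self z)))
      (Ideal.mem_sup_left this)

theorem surjective_factor {R : Type u} [CommRing R] {I J : Ideal R} (h : I ≤ J) :
    Function.Surjective (Submodule.mapQ I J LinearMap.id h) := by
  intro y
  obtain ⟨y, rfl⟩ := Ideal.Quotient.mk_surjective y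
  exact ⟨Ideal.Quotient.mk _ y, rfl⟩

theorem exists_ne_zero_mem_maximalIdeal (hdim : ringKrullDim R = 1) :
    ∃ x ∈ maximalIdeal R, x ≠ 0 := by
  by_contra! h
  have : IsField R := by
    rw [IsLocalRing.isField_iff_maximalIdeal_eq, eq_bot_iff]
    exact h
  have := ringKrullDim_eq_zero_of_isField this
  simp [this] at hdim

end Residue

/-- For `x ≠ 0` multiplication by `x` gives a free resolution of length one. The values `x = 0` and
`x = 1` serve later for `R / ⊥` and `R / ⊤`. -/
theorem extVanishes_quotient_span_singleton {R : Type u} [CommRing R] [IsDomain R] (x : R) (n : ℕ) :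
    ExtVanishes R (R ⧸ Ideal.span {x}) (n + 2) := by
  by_cases hx : x = 0
  · subst hx
    have : Function.Bijective (Submodule.mkQ (Ideal.span {(0 : R)})) :=
      ⟨by rw [← LinearMap.ker_eq_bot]; simp, Submodule.mkQ_surjective _⟩
    exact (extVanishes_of_projective R (n + 1)).of_bijective
      (f := (LinearEquiv.ofBijective _ this).symm.toLinearMap) (LinearEquiv.bijective _)
  · refine (extVanishes_of_projective R n).of_quotient (A := R) (B := R)
      (f := LinearMap.toSpanSingleton R R x) (g := Submodule.mkQ (Ideal.span {x})) ?_
      (Submodule.mkQ_surjective _) ?_ (extVanishes_of_projective R (n + 1))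
    · intro a b hab
      exact mul_right_cancel₀ hx hab
    · intro y
      rw [Submodule.mkQ_apply, Submodule.Quotient.mk_eq_zero, Ideal.mem_span_singleton']
      rfl

/-! ### One-dimensional Gorenstein domains: vanishing of `Ext` and strictness of duals. -/

section Domain

variable {R : Type u} [CommRing R] [IsDomain R] [IsNoetherianRing R] [IsLocalRing R]

theorem exists_maximalIdeal_pow_le (hdim : ringKrullDim R = 1) {J : Ideal R} (hJ : J ≠ ⊥) :
    ∃ n : ℕ, maximalIdeal R ^ n ≤ J := by
  have : Ring.KrullDimLE 1 R := (Ring.krullDimLE_iff).2 hdim.le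
  refine Ideal.exists_pow_le_of_le_radical_of_fg ?_ (IsNoetherian.noetherian _)
  rw [Ideal.radical_eq_sInf]
  refine le_sInf fun P ⟨hJP, hP⟩ => ?_
  have hP0 : P ≠ ⊥ := fun h => hJ (le_bot_iff.1 (h ▸ hJP))
  exact (eq_maximalIdeal (hP.isMaximal_of_ne_bot hP0)).ge

/-- Some power of the maximal ideal lies in `J`; the last power whose product with `I` is not inside
`J` supplies `z`. -/
theorem exists_socle_element (hdim : ringKrullDim R = 1) {I J : Ideal R} (hJ : J ≠ ⊥)
    (hIJ : ¬ I ≤ J) : ∃ z ∈ I, z ∉ J ∧ ∀ a ∈ maximalIdeal R, a * z ∈ J := by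
  classical
  have hex : ∃ n : ℕ, maximalIdeal R ^ n * I ≤ J :=
    (exists_maximalIdeal_pow_le hdim hJ).imp fun n hn => Ideal.mul_le_left.trans hn
  obtain ⟨n, hn⟩ : ∃ n, Nat.find hex = n + 1 :=
    Nat.exists_eq_succ_of_ne_zero fun h => hIJ (by simpa [h] using Nat.find_spec hex)
  have h1 := Nat.find_min hex (m := n) (by omega)
  have h2 := Nat.find_spec hex
  rw [hn] at h2
  obtain ⟨z, hz, hzJ⟩ := SetLike.not_le_iff_exists.1 h1
  refine ⟨z, Ideal.mul_le_right hz, hzJ, fun a ha => h2 ?_⟩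
  rw [pow_succ', mul_assoc]
  exact Ideal.mul_mem_mul ha hz

/-- Over a one-dimensional local domain, vanishing of `Ext ^ (n + 3) (R / I, R)` for all `I`
propagates down to `Ext ^ (n + 2)`. -/
theorem extVanishes_quotient_of_succ (hdim : ringKrullDim R = 1) {n : ℕ}
    (h : ∀ I : Ideal R, ExtVanishes R (R ⧸ I) (n + 3)) (I : Ideal R) :
    ExtVanishes R (R ⧸ I) (n + 2) := by
  -- The residue field embeds into `R / x R`, where `Ext` already vanishes; the cokernel is cyclic
  -- and is covered by `h` one degree higher.
  have hk : ExtVanishes R (R ⧸ maximalIdeal R) (n + 2) := by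
    obtain ⟨x, hxm, hx⟩ := exists_ne_zero_mem_maximalIdeal hdim
    obtain ⟨z, -, hzx, hz⟩ := exists_socle_element hdim (I := ⊤) (J := Ideal.span {x})
      (by simpa using hx) (by simpa [Ideal.span_singleton_eq_top] using hxm)
    exact (extVanishes_quotient_span_singleton x n).of_sub
      (residueMulHom_injective _ (by rwa [Submodule.mkQ_apply, Ne, Submodule.Quotient.mk_eq_zero]))
      (surjective_factor le_sup_left) (exact_residueMulHom_factor hz) (h _)
  induction I using IsNoetherian.induction with
  | hgt I ih =>
  by_cases hI : I = ⊥
  · have := extVanishes_quotient_span_singleton (0 : R) n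
    rw [Ideal.span_singleton_zero] at this
    rwa [hI]
  by_cases hI1 : I = ⊤
  · subst hI1
    have := extVanishes_quotient_span_singleton (1 : R) n
    rwa [Ideal.span_singleton_one] at this
  obtain ⟨z, -, hzx, hz⟩ := exists_socle_element hdim (I := ⊤) (J := I) hI
    (by simpa using hI1)
  refine hk.of_ends
      (residueMulHom_injective _ (by rwa [Submodule.mkQ_apply, Ne, Submodule.Quotient.mk_eq_zero]))
      (surjective_factor le_sup_left) (exact_residueMulHom_factor hz) (ih _ ?_)
  exact lt_of_le_of_ne le_sup_left fun h => hzx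
    (h ▸ Ideal.mem_sup_right (Ideal.mem_span_singleton_self z))

theorem extVanishes_quotient_two (hdim : ringKrullDim R = 1) (hGor : IsGorensteinLocalRing R)
    (I : Ideal R) : ExtVanishes R (R ⧸ I) 2 := by
  obtain ⟨-, d, hd⟩ := hGor
  -- Descending induction on the degree: `m` bounds the number of steps from degree `n + 2` up to
  -- the range where the injective dimension gives vanishing.
  suffices ∀ m n : ℕ, d ≤ m + n → ∀ I : Ideal R, ExtVanishes R (R ⧸ I) (n + 2) from
    this d 0 (by omega) I
  intro m
  induction m with
  | zero => exact fun n hn I => .of_hasInjectiveDimensionLE hd _ (by omega)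
  | succ m ih => exact fun n hn => extVanishes_quotient_of_succ hdim (ih (n + 1) (by omega))

theorem extVanishes_ideal_one (hdim : ringKrullDim R = 1) (hGor : IsGorensteinLocalRing R)
    (I : Ideal R) : ExtVanishes R I 1 :=
  (extVanishes_of_projective R 0).of_sub I.injective_subtype (Submodule.mkQ_surjective I)
    (LinearMap.exact_subtype_mkQ I) (extVanishes_quotient_two hdim hGor I)

/-- For `z` in the socle modulo `x R`, the map `a ↦ a z / x` from the maximal ideal to `R` sends `x`
to `z`; an extension to `R` would put `z` in `x R`. -/
theorem not_extVanishes_residue_one (hdim : ringKrullDim R = 1) :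
    ¬ ExtVanishes R (R ⧸ maximalIdeal R) 1 := by
  intro h
  obtain ⟨x, hxm, hx⟩ := exists_ne_zero_mem_maximalIdeal hdim
  obtain ⟨z, -, hzx, hz⟩ := exists_socle_element hdim (I := ⊤) (J := Ideal.span {x})
    (by simpa using hx) (by simpa [Ideal.span_singleton_eq_top] using hxm)
  have hz' : ∀ a : maximalIdeal R, ∃ b, b * x = a * z := fun a =>
    Ideal.mem_span_singleton'.1 (hz a a.2)
  choose q hq using hz'
  let φ : maximalIdeal R →ₗ[R] R :=
    { toFun := q
      map_add' := fun a b => mul_right_cancel₀ hx (by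
        rw [add_mul, hq, hq, hq, Submodule.coe_add, add_mul])
      map_smul' := fun r a => mul_right_cancel₀ hx (by
        simp only [smul_eq_mul, RingHom.id_apply, mul_assoc, hq, Submodule.coe_smul]) }
  obtain ⟨ψ, hψ⟩ := h.exists_extension (maximalIdeal R).injective_subtype
    (Submodule.mkQ_surjective _) (LinearMap.exact_subtype_mkQ _) φ
  have h1 : ψ x = q ⟨x, hxm⟩ := congrArg (fun f => f ⟨x, hxm⟩) hψ
  have h2 : q ⟨x, hxm⟩ = z := mul_right_cancel₀ hx (by rw [hq, mul_comm])
  apply hzx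
  rw [← h2, ← h1, Ideal.mem_span_singleton']
  exact ⟨ψ 1, by rw [mul_comm, ← smul_eq_mul, ← map_smul, smul_eq_mul, mul_one]⟩

/-- Over a one-dimensional Gorenstein local domain, the dual of a nonzero ideal is strictly larger
than the dual of any strictly larger ideal. -/
theorem le_of_forall_extension (hdim : ringKrullDim R = 1) (hGor : IsGorensteinLocalRing R)
    {I J : Ideal R} (hJ : J ≠ ⊥) (hJI : J ≤ I)
    (h : ∀ φ : J →ₗ[R] R, ∃ ψ : I →ₗ[R] R, ψ ∘ₗ Submodule.inclusion hJI = φ) : I ≤ J := by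
  by_contra hIJ
  obtain ⟨z, hzI, hzJ, hz⟩ := exists_socle_element hdim hJ hIJ
  apply not_extVanishes_residue_one hdim
  let I' : Ideal R := J ⊔ Ideal.span {z}
  have hJI' : J ≤ I' := le_sup_left
  -- The quotient `I' / J` is the residue field. Since `Ext ^ 1 (I', R) = 0` and maps from `J`
  -- extend to `I'`, its `Ext ^ 1` would vanish.
  have hI'I : I' ≤ I := sup_le hJI (by simpa [Ideal.span_le] using hzI)
  have hzI' : z ∈ I' := Ideal.mem_sup_right (Ideal.mem_span_singleton_self z)
  let N := LinearMap.range (Submodule.inclusion hJI')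
  have hN : ∀ y : I', y ∈ N ↔ (y : R) ∈ J := by
    intro y
    constructor
    · rintro ⟨w, rfl⟩
      exact w.2
    · exact fun hy => ⟨⟨y, hy⟩, rfl⟩
  have hQ : ExtVanishes R (I' ⧸ N) 1 := by
    refine (extVanishes_ideal_one hdim hGor I').of_forall_extension
      (f := Submodule.inclusion hJI') (Submodule.inclusion_injective _)
      (Submodule.mkQ_surjective N) ?_ fun φ => ?_
    · exact LinearMap.exact_map_mkQ_range _
    · obtain ⟨ψ, hψ⟩ := h φ
      exact ⟨ψ ∘ₗ Submodule.inclusion hI'I, hψ⟩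
  have hz0 : ∀ a ∈ maximalIdeal R, a • N.mkQ ⟨z, hzI'⟩ = 0 := fun a ha => by
    rw [← map_smul, Submodule.mkQ_apply, Submodule.Quotient.mk_eq_zero, hN]
    exact hz a ha
  refine hQ.of_bijective (f := residueMulHom (N.mkQ ⟨z, hzI'⟩) hz0)
    ⟨residueMulHom_injective _ ?_, ?_⟩
  · rwa [Submodule.mkQ_apply, Ne, Submodule.Quotient.mk_eq_zero, hN]
  · intro y
    obtain ⟨⟨y, hy⟩, rfl⟩ := N.mkQ_surjective y
    obtain ⟨j, hj, w, hw, rfl⟩ := Submodule.mem_sup.1 hy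
    obtain ⟨r, rfl⟩ := Ideal.mem_span_singleton'.1 hw
    refine ⟨Ideal.Quotient.mk _ r, ?_⟩
    rw [residueMulHom_mk, ← map_smul, Submodule.mkQ_apply, Submodule.mkQ_apply,
      Submodule.Quotient.eq, hN]
    simpa using hj

end Domain

end TraceIdeals

namespace TraceIdeals

universe u v

open IsLocalRing IsDiscreteValuationRing

/-! ### Trace ideals as ideals stable under all maps to `R`. -/

section Trace

variable {R : Type u} [CommRing R]

/-- Every `ψ : M → R` lands in the trace, so `φ ∘ ψ` is again a map `M → R`. -/
theorem IsTraceIdeal.apply_mem {I : Ideal R} (hI : IsTraceIdeal I) (φ : I →ₗ[R] R) (x : I) :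
    φ x ∈ I := by
  obtain ⟨M, _, _, -, rfl⟩ := hI
  have h : ∀ ψ : M →ₗ[R] R, ∀ y : M, ψ y ∈ moduleTrace R M := fun ψ y =>
    Submodule.mem_iSup_of_mem (p := fun φ : M →ₗ[R] R => LinearMap.range φ) ψ ⟨y, rfl⟩
  obtain ⟨x, hx⟩ := x
  have key : moduleTrace R M ≤
      (Submodule.comap φ (moduleTrace R M)).map (moduleTrace R M).subtype := by
    refine iSup_le fun ψ => ?_
    rintro _ ⟨y, rfl⟩
    exact ⟨⟨ψ y, h ψ y⟩, h (φ ∘ₗ ψ.codRestrict _ (h ψ)) y, rfl⟩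
  obtain ⟨x', hx', rfl⟩ := key hx
  exact hx'

theorem isTraceIdeal_of_apply_mem [IsNoetherianRing R] {I : Ideal R}
    (h : ∀ φ : I →ₗ[R] R, ∀ x : I, φ x ∈ I) : IsTraceIdeal I := by
  refine ⟨I, inferInstance, inferInstance, inferInstance, le_antisymm ?_ (iSup_le ?_)⟩
  · exact fun x hx => Submodule.mem_iSup_of_mem
      (p := fun φ : I →ₗ[R] R => LinearMap.range φ) I.subtype ⟨⟨x, hx⟩, rfl⟩
  · rintro φ _ ⟨x, rfl⟩
    exact h φ x

/-- For `x ≠ 0` with `z I ⊆ x R`, the map `I → R`, `i ↦ z i / x`. -/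
theorem exists_linearMap_of_dvd [IsDomain R] {I : Ideal R} {x z : R} (hx : x ≠ 0)
    (h : ∀ i ∈ I, x ∣ z * i) : ∃ φ : I →ₗ[R] R, ∀ i : I, x * φ i = z * i := by
  choose q hq using fun i : I => h i i.2
  refine ⟨⟨⟨q, fun a b => mul_left_cancel₀ hx ?_⟩, fun r a => mul_left_cancel₀ hx ?_⟩,
    fun i => (hq i).symm⟩
  · rw [mul_add, ← hq, ← hq, ← hq, Submodule.coe_add, mul_add]
  · rw [RingHom.id_apply, smul_eq_mul, mul_left_comm, ← hq, ← hq, Submodule.coe_smul, smul_eq_mul,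
      mul_left_comm]

/-- Multiplication by `z / x` maps `I` to `R` and sends `x` to `z`. This is the form in which the
trace property is used below. -/
theorem IsTraceIdeal.mem_of_forall_dvd [IsDomain R] {I : Ideal R} (hI : IsTraceIdeal I) {x z : R}
    (hx : x ≠ 0) (hxI : x ∈ I) (h : ∀ i ∈ I, x ∣ z * i) : z ∈ I := by
  obtain ⟨φ, hφ⟩ := exists_linearMap_of_dvd hx h
  have : φ ⟨x, hxI⟩ = z := mul_left_cancel₀ hx (by rw [hφ, mul_comm])
  exact this ▸ hI.apply_mem φ ⟨x, hxI⟩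

end Trace

/-! ### Values, successive approximation and integral closure of ideals. -/

section Valuation

/-- The ideal of elements of valuation at least `c`. -/
noncomputable def valIdeal (B : Type v) [CommRing B] [IsDomain B] [IsDiscreteValuationRing B]
    (c : ℕ) : Ideal B where
  carrier := {b | (c : ℕ∞) ≤ addVal B b}
  zero_mem' := by simp
  add_mem' ha hb := (le_min ha hb).trans addVal_add
  smul_mem' a b hb := by
    rw [Set.mem_ofPred_eq, smul_eq_mul, addVal_mul]
    exact le_add_left hb

variable {B : Type v} [CommRing B] [IsDomain B] [IsDiscreteValuationRing B]

theorem mem_valIdeal {c : ℕ} {b : B} : b ∈ valIdeal B c ↔ (c : ℕ∞) ≤ addVal B b := Iff.rfl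

theorem valIdeal_anti {c d : ℕ} (h : c ≤ d) : valIdeal B d ≤ valIdeal B c := fun _ hb =>
  le_trans (by exact_mod_cast h) (mem_valIdeal.1 hb)

theorem mul_mem_valIdeal {c d : ℕ} {a b : B} (ha : a ∈ valIdeal B c) (hb : b ∈ valIdeal B d) :
    a * b ∈ valIdeal B (c + d) := by
  rw [mem_valIdeal, addVal_mul, Nat.cast_add]
  exact add_le_add ha hb

theorem pow_mem_valIdeal {c : ℕ} {a : B} (ha : a ∈ valIdeal B c) (n : ℕ) :
    a ^ n ∈ valIdeal B (n * c) := by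
  rw [mem_valIdeal, addVal_pow, nsmul_eq_mul, Nat.cast_mul]
  exact mul_le_mul_right ha _

theorem exists_addVal_eq_natCast {b : B} (hb : b ≠ 0) : ∃ n : ℕ, addVal B b = n :=
  ⟨_, (ENat.natCast_toNat (mt addVal_eq_top_iff.1 hb)).symm⟩

theorem ne_zero_of_addVal_eq_natCast {b : B} {n : ℕ} (h : addVal B b = n) : b ≠ 0 := by
  rintro rfl
  rw [addVal_zero] at h
  exact ENat.natCast_ne_top n h.symm

theorem exists_addVal_eq (n : ℕ) : ∃ b : B, addVal B b = n := by
  obtain ⟨ϖ, hϖ⟩ := exists_irreducible B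
  exact ⟨ϖ ^ n, hϖ.addVal_pow n⟩

theorem addVal_eq_of_sub_mem {b b' : B} {n : ℕ} (h : addVal B b = n)
    (hsub : b' - b ∈ valIdeal B (n + 1)) : addVal B b' = n := by
  have hlt : addVal B b < addVal B (b' - b) := by
    rw [h]
    exact lt_of_lt_of_le (by exact_mod_cast n.lt_succ_self) (mem_valIdeal.1 hsub)
  have := AddValuation.map_add_eq_of_lt_right (addVal B) hlt
  rwa [sub_add_cancel, h] at this

variable {R : Type u} [CommRing R] [Algebra R B]

/-- Every element of `B` is congruent to an element of `R` modulo the maximal ideal of `B`. -/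
def HasResidueLifts (R : Type u) [CommRing R] (B : Type v) [CommRing B] [IsDomain B]
    [IsDiscreteValuationRing B] [Algebra R B] : Prop := ∀ b : B, ∃ r : R, b - algebraMap R B r ∈ valIdeal B 1

theorem HasResidueLifts.exists_lt_addVal_sub (hres : HasResidueLifts R B) {b u : B} {n : ℕ}
    (hb : addVal B b = n) (hu : addVal B u = n) : ∃ r : R, b - r • u ∈ valIdeal B (n + 1) := by
  obtain ⟨w, rfl⟩ := addVal_le_iff_dvd.1 (hu.trans hb.symm).le
  obtain ⟨r, hr⟩ := hres w
  refine ⟨r, ?_⟩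
  rw [Algebra.smul_def, mul_comm _ u, ← mul_sub]
  exact mul_mem_valIdeal hu.ge hr

/-- Successive approximation: subtracting an `R`-multiple of `y'` from `y` raises the value, until
the remainder has value at least `c`. -/
theorem HasResidueLifts.le_of_addVal (hres : HasResidueLifts R B) {M N : Submodule R B} {c : ℕ}
    (hN : ∀ b ∈ valIdeal B c, b ∈ N)
    (h : ∀ y ∈ M, ∀ n : ℕ, addVal B y = n → n < c → ∃ y' ∈ M, y' ∈ N ∧ addVal B y' = n) :
    M ≤ N := by
  suffices ∀ k n : ℕ, c ≤ n + k → ∀ y ∈ M, y ∈ valIdeal B n → y ∈ N from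
    fun y hy => this c 0 (by omega) y hy (by simp [mem_valIdeal])
  intro k
  induction k with
  | zero => exact fun n hn y _ hyn => hN y (valIdeal_anti hn hyn)
  | succ k ih =>
    intro n hn y hyM hyn
    by_cases hyn1 : y ∈ valIdeal B (n + 1)
    · exact ih (n + 1) (by omega) y hyM hyn1
    have hv : addVal B y = n := by
      refine le_antisymm (Order.le_of_lt_add_one ?_) hyn
      simpa [mem_valIdeal] using hyn1
    by_cases hnc : n < c
    · obtain ⟨y', hy'M, hy'N, hy'⟩ := h y hyM n hv hnc
      obtain ⟨r, hr⟩ := hres.exists_lt_addVal_sub hv hy'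
      have := ih (n + 1) (by omega) _ (M.sub_mem hyM (M.smul_mem r hy'M)) hr
      simpa using N.add_mem this (N.smul_mem r hy'N)
    · exact hN y (valIdeal_anti (by omega) hyn)

/-- The elements of `B` of valuation at least `c` lie in the image of `R`. -/
def ContainsValIdeal (R : Type u) [CommRing R] (B : Type v) [CommRing B] [IsDomain B]
    [IsDiscreteValuationRing B] [Algebra R B] (c : ℕ) : Prop :=
  ∀ b ∈ valIdeal B c, ∃ r : R, algebraMap R B r = b

theorem mem_valueSemigroup [IsDomain R] {n : ℕ} :
    n ∈ valueSemigroup R B ↔ ∃ r : R, addVal B (algebraMap R B r) = n := by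
  constructor
  · rintro ⟨r, -, hr⟩
    exact ⟨r, hr⟩
  · rintro ⟨r, hr⟩
    refine ⟨r, ?_, hr⟩
    rintro rfl
    exact ne_zero_of_addVal_eq_natCast hr (map_zero _)

/-- Replaces an arbitrary bound `C` by any bound read off from the value semigroup. -/
theorem ContainsValIdeal.of_mem_valueSemigroup [IsDomain R] (hres : HasResidueLifts R B) {C c : ℕ}
    (hC : ContainsValIdeal R B C) (h : ∀ n, c ≤ n → n ∈ valueSemigroup R B) :
    ContainsValIdeal R B c := by
  have key : (valIdeal B c).restrictScalars R ≤ LinearMap.range (Algebra.linearMap R B) := by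
    refine hres.le_of_addVal (c := C) (fun b hb => hC b hb) fun y hy n hn _ => ?_
    have hcn : c ≤ n := by
      have := mem_valIdeal.1 (show y ∈ valIdeal B c from hy)
      rw [hn] at this
      exact_mod_cast this
    obtain ⟨r, hr⟩ := mem_valueSemigroup.1 (h n hcn)
    refine ⟨algebraMap R B r, ?_, ⟨r, rfl⟩, hr⟩
    change _ ∈ valIdeal B c
    rw [mem_valIdeal, hr]
    exact_mod_cast hcn
  exact fun b hb => key hb

theorem exists_minimal_addVal [IsDomain R] [FaithfulSMul R B] {I : Ideal R} (hI : I ≠ ⊥) :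
    ∃ x ∈ I, x ≠ 0 ∧ ∃ m : ℕ, addVal B (algebraMap R B x) = m ∧
      ∀ i ∈ I, algebraMap R B i ∈ valIdeal B m := by
  classical
  obtain ⟨x, hx, hx0⟩ := Submodule.exists_mem_ne_zero_of_ne_bot hI
  have hinj := FaithfulSMul.algebraMap_injective R B
  have hex : ∃ m : ℕ, ∃ x ∈ I, x ≠ 0 ∧ addVal B (algebraMap R B x) = m := by
    obtain ⟨n, hn⟩ := exists_addVal_eq_natCast ((map_ne_zero_iff _ hinj).2 hx0)
    exact ⟨n, x, hx, hx0, hn⟩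
  obtain ⟨x, hx, hx0, hm⟩ := Nat.find_spec hex
  refine ⟨x, hx, hx0, _, hm, fun i hi => ?_⟩
  by_cases hi0 : i = 0
  · simp [hi0]
  obtain ⟨n, hn⟩ := exists_addVal_eq_natCast ((map_ne_zero_iff _ hinj).2 hi0)
  rw [mem_valIdeal, hn]
  exact_mod_cast Nat.find_min' hex ⟨i, hi, hi0, hn⟩

/-- If `x` has least value in `I`, then `i / x ∈ B` for `i ∈ I`, so `r i / x` has value at least `c`
and lies in `R`. -/
theorem IsTraceIdeal.mem_of_mem_valIdeal [IsDomain R] [FaithfulSMul R B] {I : Ideal R}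
    (hI : IsTraceIdeal I) (hI0 : I ≠ ⊥) {c : ℕ} (hc : ContainsValIdeal R B c) {r : R}
    (hr : algebraMap R B r ∈ valIdeal B c) : r ∈ I := by
  obtain ⟨x, hx, hx0, m, hm, hmin⟩ := exists_minimal_addVal (B := B) hI0
  refine hI.mem_of_forall_dvd hx0 hx fun i hi => ?_
  obtain ⟨b, hb⟩ := addVal_le_iff_dvd.1 (hm.le.trans (hmin i hi))
  obtain ⟨s, hs⟩ := hc _ ((valIdeal B c).mul_mem_right b hr)
  refine ⟨s, FaithfulSMul.algebraMap_injective R B ?_⟩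
  rw [map_mul, map_mul, hb, hs]
  ring

theorem IsIntegralOverIdeal.mem_valIdeal {I : Ideal R} {m : ℕ}
    (hI : ∀ i ∈ I, algebraMap R B i ∈ valIdeal B m) {x : R} (hx : IsIntegralOverIdeal I x) :
    algebraMap R B x ∈ valIdeal B m := by
  obtain ⟨n, a, hn, ha, h⟩ := hx
  by_contra hxm
  have hlt : addVal B (algebraMap R B x) < m := by simpa [TraceIdeals.mem_valIdeal] using hxm
  obtain ⟨k, hk⟩ := ENat.ne_top_iff_exists.1 hlt.ne_top
  rw [← hk] at hlt
  have hkm : k < m := by exact_mod_cast hlt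
  have hpow : ∀ i, ∀ y ∈ I ^ i, algebraMap R B y ∈ valIdeal B (i * m) := by
    intro i
    induction i with
    | zero => simp [TraceIdeals.mem_valIdeal]
    | succ i ih =>
      intro y hy
      rw [pow_succ] at hy
      refine Submodule.mul_induction_on hy (fun p hp q hq => ?_) fun p q hp hq => ?_
      · rw [map_mul, add_mul, one_mul]
        exact mul_mem_valIdeal (ih p hp) (hI q hq)
      · rw [map_add]
        exact add_mem hp hq
  -- Each term `a i * x ^ (n - i)` has value at least `i m + (n - i) k > n k`, because `i ≥ 1` and
  -- `k < m`.
  have hxn : algebraMap R B x ^ n ∈ valIdeal B (n * k + 1) := by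
    rw [← map_pow, eq_neg_of_add_eq_zero_left h, map_neg, map_sum]
    refine neg_mem (sum_mem fun i hi => ?_)
    rw [map_mul, map_pow]
    refine valIdeal_anti ?_ (mul_mem_valIdeal (hpow i _ (ha i hi)) (pow_mem_valIdeal hk.le (n - i)))
    obtain ⟨h1, h2⟩ := Finset.mem_Icc.1 hi
    obtain ⟨j, rfl⟩ := Nat.exists_eq_add_of_le h2
    rw [Nat.add_sub_cancel_left]
    nlinarith
  rw [TraceIdeals.mem_valIdeal, addVal_pow, ← hk, nsmul_eq_mul] at hxn
  have : n * k + 1 ≤ n * k := by exact_mod_cast hxn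
  omega

/-- The quotient `x / y` lies in `B`; multiplying its integral equation over `R` by a power of `y`
makes `x` integral over `I`. -/
theorem IsIntegrallyClosedIdeal.mem_of_addVal_le [FaithfulSMul R B] [Algebra.IsIntegral R B]
    {I : Ideal R} (hI : IsIntegrallyClosedIdeal I) {x y : R} (hy : y ∈ I)
    (h : addVal B (algebraMap R B y) ≤ addVal B (algebraMap R B x)) : x ∈ I := by
  obtain ⟨b, hb⟩ := addVal_le_iff_dvd.1 h
  obtain ⟨p, hp, hpb⟩ := Algebra.IsIntegral.isIntegral (R := R) b
  have hp1 : p.natDegree ≠ 0 := by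
    intro h0
    rw [hp.natDegree_eq_zero.1 h0] at hpb
    simp at hpb
  apply hI
  refine ⟨p.natDegree, fun i => p.coeff (p.natDegree - i) * y ^ i, Nat.pos_of_ne_zero hp1,
    fun i _ => Ideal.mul_mem_left _ _ (Ideal.pow_mem_pow hy i),
    FaithfulSMul.algebraMap_injective R B ?_⟩
  rw [Polynomial.eval₂_eq_sum_range, Finset.sum_range_succ, hp.coeff_natDegree, map_one,
    one_mul] at hpb
  have hre : ∑ i ∈ Finset.Icc 1 p.natDegree, algebraMap R B (p.coeff (p.natDegree - i)) *
      b ^ (p.natDegree - i) =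
      ∑ i ∈ Finset.range p.natDegree, algebraMap R B (p.coeff i) * b ^ i := by
    refine Finset.sum_bij' (fun i _ => p.natDegree - i) (fun i _ => p.natDegree - i) ?_ ?_ ?_ ?_ ?_
    all_goals intro i hi
    all_goals simp only [Finset.mem_Icc, Finset.mem_range] at *
    all_goals omega
  have : algebraMap R B (x ^ p.natDegree + ∑ i ∈ Finset.Icc 1 p.natDegree,
      p.coeff (p.natDegree - i) * y ^ i * x ^ (p.natDegree - i)) =
      algebraMap R B y ^ p.natDegree * (b ^ p.natDegree +
        ∑ i ∈ Finset.Icc 1 p.natDegree, algebraMap R B (p.coeff (p.natDegree - i)) *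
          b ^ (p.natDegree - i)) := by
    rw [map_add, map_pow, hb, map_sum, mul_add, mul_pow, Finset.mul_sum]
    congr 1
    refine Finset.sum_congr rfl fun i hi => ?_
    obtain ⟨-, h2⟩ := Finset.mem_Icc.1 hi
    rw [map_mul, map_mul, map_pow, map_pow, hb, mul_pow]
    conv_rhs => rw [← Nat.add_sub_cancel' h2, pow_add, Nat.add_sub_cancel_left]
    ring
  rw [this, hre, add_comm (b ^ _), hpb, mul_zero, map_zero]

theorem finite_isTraceIdeal_of_isIntegrallyClosedIdeal [IsDomain R] [FaithfulSMul R B]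
    [Algebra.IsIntegral R B] {c : ℕ} (hc : ContainsValIdeal R B c)
    (h : ∀ I : Ideal R, IsTraceIdeal I → IsIntegrallyClosedIdeal I) :
    {I : Ideal R | IsTraceIdeal I}.Finite := by
  refine (((Set.finite_Iic c).image fun n => (valIdeal B n).comap (algebraMap R B)).insert
    ⊥).subset fun I (hI : IsTraceIdeal I) => ?_
  by_cases hI0 : I = ⊥
  · exact Or.inl hI0
  obtain ⟨x, hx, hx0, m, hm, hmin⟩ := exists_minimal_addVal (B := B) hI0
  refine Or.inr ⟨m, ?_, le_antisymm (fun r hr => ?_) hmin⟩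
  · obtain ⟨b, hb⟩ := exists_addVal_eq (B := B) c
    obtain ⟨r, rfl⟩ := hc b hb.ge
    have := TraceIdeals.mem_valIdeal.1 (hmin r (hI.mem_of_mem_valIdeal hI0 hc hb.ge))
    rw [hb] at this
    exact_mod_cast this
  · exact (h I hI).mem_of_addVal_le hx (hm.le.trans hr)

end Valuation

end TraceIdeals

namespace TraceIdeals

universe u v

open IsLocalRing IsDiscreteValuationRing

/-! ### The overrings attached to two consecutive gaps. -/

section Values

variable {R : Type u} [CommRing R] [IsDomain R] {B : Type v} [CommRing B] [IsDomain B]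
  [IsDiscreteValuationRing B] [Algebra R B]

theorem algebraMap_mem_valIdeal_succ {r : R} {n : ℕ} (hr : algebraMap R B r ∈ valIdeal B n)
    (hn : n ∉ valueSemigroup R B) : algebraMap R B r ∈ valIdeal B (n + 1) := by
  by_contra h
  refine hn (mem_valueSemigroup.2 ⟨r, le_antisymm (Order.le_of_lt_add_one ?_) hr⟩)
  simpa [mem_valIdeal] using h

/-- The overring `R + R u + {v ≥ p + 2}` of `R`, where `v u ≥ p ≥ 2`. -/
def overring (u : B) (p : ℕ) (hp : 2 ≤ p) (hu : u ∈ valIdeal B p) : Subalgebra R B where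
  carrier := {b | ∃ r s : R, b - algebraMap R B r - algebraMap R B s * u ∈ valIdeal B (p + 2)}
  algebraMap_mem' r := ⟨r, 0, by simp⟩
  add_mem' := by
    rintro a b ⟨r, s, h⟩ ⟨r', s', h'⟩
    refine ⟨r + r', s + s', ?_⟩
    convert add_mem h h' using 1
    rw [map_add, map_add]
    ring
  mul_mem' := by
    rintro a b ⟨r, s, h⟩ ⟨r', s', h'⟩
    refine ⟨r * r', r * s' + s * r', ?_⟩
    -- Here `p ≥ 2` is needed: `2 p ≥ p + 2`.
    have huu : u * u ∈ valIdeal B (p + 2) := valIdeal_anti (by omega) (mul_mem_valIdeal hu hu)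
    convert add_mem (add_mem (Ideal.mul_mem_left _ b h)
      (Ideal.mul_mem_left _ (algebraMap R B r + algebraMap R B s * u) h'))
      (Ideal.mul_mem_left _ (algebraMap R B (s * s')) huu) using 1
    rw [map_add, map_mul, map_mul, map_mul, map_mul]
    ring

/-- In `y = r + s u + e` of value `p + 1`, the gaps `p, p + 1` push `r` to value at least `p + 2`.
Then `s` has positive value, hence at least `2` since `1` is a gap too, so `y` would have value at
least `p + 2`. -/
theorem addVal_ne_of_mem_overring {u : B} {p : ℕ} (hp : 2 ≤ p) (hu : addVal B u = p)
    (hpH : p ∉ valueSemigroup R B) (hpH' : p + 1 ∉ valueSemigroup R B) {y : B}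
    (hy : y ∈ overring (R := R) u p hp hu.ge) : addVal B y ≠ (p + 1 : ℕ) := by
  intro hyp
  obtain ⟨r, s, he⟩ := hy
  have hyp' : y ∈ valIdeal B (p + 1) := hyp.ge
  have hup : u ∈ valIdeal B p := hu.ge
  have h1 : (1 : ℕ) ∉ valueSemigroup R B := fun h1 =>
    hpH (by simpa using (valueSemigroup R B).nsmul_mem h1 p)
  have hr : algebraMap R B r ∈ valIdeal B p := by
    have := sub_mem (sub_mem (valIdeal_anti (Nat.le_succ p) hyp')
      (Ideal.mul_mem_left _ (algebraMap R B s) hup)) (valIdeal_anti (by omega) he)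
    convert this using 1
    ring
  have hr' : algebraMap R B r ∈ valIdeal B (p + 2) :=
    algebraMap_mem_valIdeal_succ (algebraMap_mem_valIdeal_succ hr hpH) hpH'
  have hsu : algebraMap R B s * u ∈ valIdeal B (p + 1) := by
    have := sub_mem (sub_mem hyp' (valIdeal_anti (Nat.le_succ _) hr'))
      (valIdeal_anti (Nat.le_succ _) he)
    convert this using 1
    ring
  have hs : algebraMap R B s ∈ valIdeal B (0 + 1) := by
    rw [mem_valIdeal, addVal_mul, hu, add_comm p, Nat.cast_add] at hsu
    rw [mem_valIdeal, zero_add]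
    exact (ENat.add_le_add_iff_right (ENat.natCast_ne_top p)).1 hsu
  have hs' : algebraMap R B s ∈ valIdeal B 2 := algebraMap_mem_valIdeal_succ hs h1
  have : y ∈ valIdeal B (p + 2) := by
    have := add_mem (add_mem he hr') (valIdeal_anti (add_comm 2 p).ge (mul_mem_valIdeal hs' hup))
    convert this using 1
    ring
  rw [mem_valIdeal, hyp] at this
  have : p + 2 ≤ p + 1 := by exact_mod_cast this
  omega

end Values

/-! ### Trace ideals are integrally closed under the semigroup condition. -/

section IntegrallyClosed

variable {R : Type u} [CommRing R] [IsDomain R] {B : Type v} [CommRing B] [IsDomain B]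
  [IsDiscreteValuationRing B] [Algebra R B] [FaithfulSMul R B]

theorem isIntegrallyClosedIdeal_bot {R : Type u} [CommRing R] [IsDomain R] : IsIntegrallyClosedIdeal (⊥ : Ideal R) := by
  rintro x ⟨n, a, hn, ha, h⟩
  rw [Finset.sum_eq_zero, add_zero] at h
  · exact eq_zero_of_pow_eq_zero h
  · intro i hi
    have h0 := ha i hi
    have hi1 := (Finset.mem_Icc.1 hi).1
    rw [← Ideal.zero_eq_bot, zero_pow (by omega), Ideal.zero_eq_bot, Ideal.mem_bot] at h0
    rw [h0, zero_mul]

/-- If, below the conductor, all but at most one element of each `H ∩ [m, ∞)`, `m ∈ H`, lie in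
`m + H`, then every trace ideal is integrally closed. -/
theorem IsTraceIdeal.isIntegrallyClosedIdeal (hres : HasResidueLifts R B) {c : ℕ}
    (hc : ContainsValIdeal R B c)
    (hH : ∀ m ∈ valueSemigroup R B, ∀ p ∈ valueSemigroup R B, ∀ q ∈ valueSemigroup R B,
      m ≤ p → p < c → m ≤ q → q < c → (∀ h ∈ valueSemigroup R B, p ≠ m + h) →
      (∀ h ∈ valueSemigroup R B, q ≠ m + h) → p = q)
    {I : Ideal R} (hI : IsTraceIdeal I) : IsIntegrallyClosedIdeal I := by
  by_cases hI0 : I = ⊥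
  · rw [hI0]
    exact isIntegrallyClosedIdeal_bot
  have hinj := FaithfulSMul.algebraMap_injective R B
  obtain ⟨x₀, hx₀, hx₀0, m, hm, hmin⟩ := exists_minimal_addVal (B := B) hI0
  intro x hx
  have hxm := hx.mem_valIdeal hmin
  by_cases hall : ∀ n ∈ valueSemigroup R B, m ≤ n → n < c →
      ∃ i ∈ I, addVal B (algebraMap R B i) = n
  · have key : Submodule.map (Algebra.linearMap R B) ((valIdeal B m).comap (algebraMap R B)) ≤
        Submodule.map (Algebra.linearMap R B) I := by
      refine hres.le_of_addVal (c := c) (fun b hb => ?_) ?_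
      · obtain ⟨r, rfl⟩ := hc b hb
        exact ⟨r, hI.mem_of_mem_valIdeal hI0 hc hb, rfl⟩
      · rintro _ ⟨r, hr, rfl⟩ n hn hnc
        have hmn : m ≤ n := by
          have := mem_valIdeal.1 (show algebraMap R B r ∈ valIdeal B m from hr)
          rw [show addVal B (algebraMap R B r) = n from hn] at this
          exact_mod_cast this
        obtain ⟨i, hi, hin⟩ := hall n (mem_valueSemigroup.2 ⟨r, hn⟩) hmn hnc
        exact ⟨_, ⟨i, hmin i hi, rfl⟩, ⟨i, hi, rfl⟩, hin⟩
    obtain ⟨i, hi, hix⟩ := key ⟨x, hxm, rfl⟩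
    rwa [← hinj hix]
  · exfalso
    push Not at hall
    obtain ⟨q, hq, hmq, hqc, hqI⟩ := hall
    obtain ⟨z, hz⟩ := mem_valueSemigroup.1 hq
    refine hqI z (hI.mem_of_forall_dvd hx₀0 hx₀ fun i hi => ?_) hz
    have hqm : ∀ h ∈ valueSemigroup R B, q ≠ m + h := by
      rintro h hh rfl
      obtain ⟨r, hr⟩ := mem_valueSemigroup.1 hh
      exact hqI (x₀ * r) (I.mul_mem_right r hx₀)
        (by rw [map_mul, addVal_mul, hm, hr, Nat.cast_add])
    -- The missing value `q` is the only one below `c` allowed outside `m + H`, so all values of `I`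
    -- below `c` are attained by multiples of `x₀`.
    have key : Submodule.map (Algebra.linearMap R B) I ≤
        Submodule.map (Algebra.linearMap R B) (Ideal.span {x₀}) ⊔
          (valIdeal B c).restrictScalars R := by
      refine hres.le_of_addVal (c := c) (fun b hb => Submodule.mem_sup_right hb) ?_
      rintro _ ⟨j, hj, rfl⟩ n hn hnc
      have hmn : m ≤ n := by
        have := mem_valIdeal.1 (hmin j hj)
        rw [show addVal B (algebraMap R B j) = n from hn] at this
        exact_mod_cast this
      have hnH : n ∈ valueSemigroup R B := mem_valueSemigroup.2 ⟨j, hn⟩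
      obtain ⟨h, hh, rfl⟩ : ∃ h ∈ valueSemigroup R B, n = m + h := by
        by_contra! hne
        have := hH m (mem_valueSemigroup.2 ⟨x₀, hm⟩) n hnH q hq hmn hnc hmq hqc hne hqm
        subst this
        exact hqI j hj hn
      obtain ⟨r, hr⟩ := mem_valueSemigroup.1 hh
      refine ⟨algebraMap R B (x₀ * r), ⟨_, I.mul_mem_right r hx₀, rfl⟩,
        Submodule.mem_sup_left ⟨_, Ideal.mul_mem_right r _ (Ideal.mem_span_singleton_self x₀), rfl⟩,
        by rw [map_mul, addVal_mul, hm, hr, Nat.cast_add]⟩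
    obtain ⟨_, ⟨y, hy, rfl⟩, e, he, hye⟩ := Submodule.mem_sup.1 (key ⟨i, hi, rfl⟩)
    obtain ⟨r, rfl⟩ := Ideal.mem_span_singleton.1 hy
    obtain ⟨w, hw⟩ := addVal_le_iff_dvd.1
      (show addVal B (algebraMap R B x₀) ≤ addVal B (algebraMap R B z) by
        rw [hm, hz]; exact_mod_cast hmq)
    obtain ⟨s, hs⟩ := hc (w * e) ((valIdeal B c).mul_mem_left w he)
    refine ⟨z * r + s, hinj ?_⟩
    have hie : algebraMap R B i = algebraMap R B (x₀ * r) + e := hye.symm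
    rw [map_mul, hie, map_mul, map_mul, map_add, map_mul, hs, hw]
    ring

end IntegrallyClosed

/-! ### Conductors `R : N` and duality. -/

section Dual

variable {R : Type u} [CommRing R] {B : Type v} [CommRing B] [Algebra R B]

/-- The ideal of elements of `R` that multiply the `R`-submodule `N` of `B` into `R`. -/
def dualIdeal (N : Submodule R B) : Ideal R where
  carrier := {r | ∀ b ∈ N, ∃ s, algebraMap R B s = algebraMap R B r * b}
  zero_mem' := fun b _ => ⟨0, by simp⟩
  add_mem' := fun {x y} hx hy b hb => by
    obtain ⟨s, hs⟩ := hx b hb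
    obtain ⟨t, ht⟩ := hy b hb
    exact ⟨s + t, by rw [map_add, map_add, add_mul, hs, ht]⟩
  smul_mem' := fun a x hx b hb => by
    obtain ⟨s, hs⟩ := hx b hb
    exact ⟨a * s, by rw [smul_eq_mul, map_mul, map_mul, hs, mul_assoc]⟩

theorem mem_dualIdeal {N : Submodule R B} {r : R} :
    r ∈ dualIdeal N ↔ ∀ b ∈ N, ∃ s, algebraMap R B s = algebraMap R B r * b := Iff.rfl

theorem inf_dualIdeal_le (M N : Submodule R B) :
    dualIdeal M ⊓ dualIdeal N ≤ dualIdeal (M ⊔ N) := by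
  rintro r ⟨hM, hN⟩ b hb
  obtain ⟨x, hx, y, hy, rfl⟩ := Submodule.mem_sup.1 hb
  obtain ⟨s, hs⟩ := hM x hx
  obtain ⟨t, ht⟩ := hN y hy
  exact ⟨s + t, by rw [map_add, mul_add, hs, ht]⟩

variable [IsNoetherianRing R] [IsDomain B] [FaithfulSMul R B]

/-- The ideal `R : S` is an `S`-module and any `φ : (R : S) → R` is multiplication by a fraction,
hence `S`-linear. So `φ a * b = φ (a b) ∈ R` for `b ∈ S`. -/
theorem isTraceIdeal_dualIdeal (S : Subalgebra R B) :
    IsTraceIdeal (dualIdeal (Subalgebra.toSubmodule S)) := by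
  have hinj := FaithfulSMul.algebraMap_injective R B
  refine isTraceIdeal_of_apply_mem fun φ a b hb => ?_
  by_cases ha0 : a = 0
  · exact ⟨0, by simp [ha0]⟩
  obtain ⟨a', ha'⟩ := mem_dualIdeal.1 a.2 b hb
  have ha'D : a' ∈ dualIdeal (Subalgebra.toSubmodule S) := fun t ht => by
    obtain ⟨s, hs⟩ := mem_dualIdeal.1 a.2 (b * t) (S.mul_mem hb ht)
    exact ⟨s, by rw [hs, ha', mul_assoc]⟩
  refine ⟨φ ⟨a', ha'D⟩, ?_⟩
  have h1 : (a : R) * φ ⟨a', ha'D⟩ = a' * φ a := by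
    rw [← smul_eq_mul, ← smul_eq_mul, ← map_smul, ← map_smul]
    congr 1
    exact Subtype.ext (mul_comm _ _)
  have ha : algebraMap R B a ≠ 0 := (map_ne_zero_iff _ hinj).2 fun h => ha0 (Subtype.ext h)
  refine mul_left_cancel₀ ha ?_
  rw [← map_mul, h1, map_mul, ha']
  ring

variable [IsDomain R] [IsLocalRing R]

/-- Scaling by `c₀` turns `S ≤ T` into ideals of `R`. As `1 ∈ S`, a map `φ : c₀ S → R` is determined
by `φ c₀ ∈ R : S`, and it extends to `c₀ T` when `φ c₀ ∈ R : T`; `le_of_forall_extension` then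
applies. -/
theorem le_of_dualIdeal_le (hdim : ringKrullDim R = 1) (hGor : IsGorensteinLocalRing R) {c₀ : R}
    (hc₀ : c₀ ≠ 0) (hc : ∀ b : B, ∃ r : R, algebraMap R B r = algebraMap R B c₀ * b)
    {S T : Submodule R B} (hS : 1 ∈ S) (hST : S ≤ T) (h : dualIdeal S ≤ dualIdeal T) : T ≤ S := by
  have hinj := FaithfulSMul.algebraMap_injective R B
  have hc₀' : algebraMap R B c₀ ≠ 0 := (map_ne_zero_iff _ hinj).2 hc₀
  let scale (N : Submodule R B) : Ideal R := (N.map (LinearMap.mulLeft R (algebraMap R B c₀))).comap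
    (Algebra.linearMap R B)
  have hscale : ∀ (N : Submodule R B) (r : R),
      r ∈ scale N ↔ ∃ b ∈ N, algebraMap R B c₀ * b = algebraMap R B r := fun _ _ => Iff.rfl
  have hle : scale S ≤ scale T := Submodule.comap_mono (Submodule.map_mono hST)
  have hc₀S : c₀ ∈ scale S := (hscale S c₀).2 ⟨1, hS, mul_one _⟩
  have key : scale T ≤ scale S := by
    refine le_of_forall_extension hdim hGor (fun h => hc₀ ?_) hle fun φ => ?_
    · rw [h] at hc₀S
      exact hc₀S
    have hφ : ∀ j : scale S, φ ⟨c₀, hc₀S⟩ * j = c₀ * φ j := fun j => by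
      rw [mul_comm, ← smul_eq_mul, ← smul_eq_mul, ← map_smul, ← map_smul]
      congr 1
      exact Subtype.ext (mul_comm _ _)
    have hd : φ ⟨c₀, hc₀S⟩ ∈ dualIdeal S := fun s hs => by
      obtain ⟨j, hj⟩ := hc s
      refine ⟨φ ⟨j, (hscale S j).2 ⟨s, hs, hj.symm⟩⟩, mul_left_cancel₀ hc₀' ?_⟩
      rw [← map_mul, ← hφ, map_mul, hj]
      ring
    obtain ⟨ψ, hψ⟩ := exists_linearMap_of_dvd (I := scale T) (x := c₀) (z := φ ⟨c₀, hc₀S⟩) hc₀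
      fun i hi => by
        obtain ⟨t, ht, hti⟩ := (hscale T i).1 hi
        obtain ⟨s, hs⟩ := h hd t ht
        refine ⟨s, hinj ?_⟩
        rw [map_mul, map_mul, hs, ← hti]
        ring
    refine ⟨ψ, LinearMap.ext fun j => mul_left_cancel₀ hc₀ ?_⟩
    rw [← hφ]
    exact hψ _
  intro t ht
  obtain ⟨r, hr⟩ := hc t
  obtain ⟨s, hs, hsr⟩ := (hscale S r).1 (key ((hscale T r).2 ⟨t, ht, hr.symm⟩))
  rwa [← mul_left_cancel₀ hc₀' (hsr.trans hr)]

end Dual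

/-! ### Symmetry of the value semigroup and infinite families of trace ideals. -/

section Overrings

variable {R : Type u} [CommRing R] [IsDomain R] [IsNoetherianRing R] [IsLocalRing R]
  {B : Type v} [CommRing B] [IsDomain B] [IsDiscreteValuationRing B] [Algebra R B]
  [FaithfulSMul R B]

theorem le_of_dualIdeal_le_of_containsValIdeal (hdim : ringKrullDim R = 1)
    (hGor : IsGorensteinLocalRing R) {c : ℕ} (hc : ContainsValIdeal R B c)
    {S T : Submodule R B} (hS : 1 ∈ S) (hST : S ≤ T) (h : dualIdeal S ≤ dualIdeal T) : T ≤ S := by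
  obtain ⟨b, hb⟩ := exists_addVal_eq (B := B) c
  obtain ⟨c₀, rfl⟩ := hc b hb.ge
  refine le_of_dualIdeal_le hdim hGor (c₀ := c₀) ?_
    (fun b' => hc _ ((valIdeal B c).mul_mem_right b' hb.ge)) hS hST h
  rintro rfl
  exact ne_zero_of_addVal_eq_natCast hb (map_zero _)

/-- Half of the symmetry of the value semigroup of a Gorenstein ring. -/
theorem mem_valueSemigroup_of_isGorenstein (hdim : ringKrullDim R = 1)
    (hGor : IsGorensteinLocalRing R) {g h : ℕ} (hc : ContainsValIdeal R B (g + h + 1))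
    (hgh : g + h ∉ valueSemigroup R B) (hg : g ∉ valueSemigroup R B) :
    h ∈ valueSemigroup R B := by
  by_contra hh
  let A : Submodule R B := LinearMap.range (Algebra.linearMap R B)
  let N (n : ℕ) : Submodule R B := A ⊔ (valIdeal B n).restrictScalars R
  have hle : N (g + 1) ≤ N g := sup_le_sup_left (valIdeal_anti (Nat.le_succ g)) A
  have key : N g ≤ N (g + 1) := by
    refine le_of_dualIdeal_le_of_containsValIdeal hdim hGor hc
      (Submodule.mem_sup_left ⟨1, map_one (algebraMap R B)⟩) hle fun r hr => ?_
    -- If `r` had value `j ≤ h`, then `j < h` as `h` is a gap, and multiplying by an element of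
    -- value `g + h - j ≥ g + 1` would realize the gap `g + h`.
    have hrh : algebraMap R B r ∈ valIdeal B (h + 1) := by
      by_contra hrh
      have hlt : addVal B (algebraMap R B r) < (h + 1 : ℕ) := by
        simpa only [mem_valIdeal, not_le] using hrh
      obtain ⟨j, hj⟩ := ENat.ne_top_iff_exists.1 hlt.ne_top
      have hjh : j < h + 1 := by
        rw [← hj] at hlt
        exact_mod_cast hlt
      have hne : j ≠ h := by
        rintro rfl
        exact hh (mem_valueSemigroup.2 ⟨r, hj.symm⟩)
      obtain ⟨b, hb⟩ := exists_addVal_eq (B := B) (g + h - j)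
      obtain ⟨s, hs⟩ := mem_dualIdeal.1 hr b (Submodule.mem_sup_right
        (show b ∈ valIdeal B (g + 1) from valIdeal_anti (by omega) hb.ge))
      refine hgh (mem_valueSemigroup.2 ⟨s, ?_⟩)
      rw [hs, addVal_mul, hb, ← hj, ← Nat.cast_add]
      congr 1
      omega
    intro b hb
    obtain ⟨_, ⟨a, rfl⟩, e, he, rfl⟩ := Submodule.mem_sup.1 hb
    obtain ⟨s, hs⟩ := hc (algebraMap R B r * e)
      (valIdeal_anti (by omega) (mul_mem_valIdeal hrh he))
    exact ⟨r * a + s, by rw [map_add, map_mul, hs, mul_add, Algebra.linearMap_apply]⟩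
  obtain ⟨b, hb⟩ := exists_addVal_eq (B := B) g
  obtain ⟨_, ⟨a, rfl⟩, e, he, hae⟩ := Submodule.mem_sup.1
    (key (Submodule.mem_sup_right (show b ∈ valIdeal B g from hb.ge)))
  refine hg (mem_valueSemigroup.2 ⟨a, addVal_eq_of_sub_mem hb ?_⟩)
  rw [← hae, Algebra.linearMap_apply, sub_add_cancel_left]
  exact neg_mem he

/-- Two consecutive gaps `p, p + 1` of the value semigroup with `p ≥ 2` give rise to infinitely
many trace ideals. -/
theorem infinite_isTraceIdeal [Infinite (ResidueField R)] (hdim : ringKrullDim R = 1)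
    (hGor : IsGorensteinLocalRing R) {c : ℕ} (hc : ContainsValIdeal R B c) {p : ℕ} (hp : 2 ≤ p)
    (hpH : p ∉ valueSemigroup R B) (hpH' : p + 1 ∉ valueSemigroup R B) :
    {I : Ideal R | IsTraceIdeal I}.Infinite := by
  obtain ⟨t, ht⟩ := exists_addVal_eq (B := B) p
  obtain ⟨t', ht'⟩ := exists_addVal_eq (B := B) (p + 1)
  have hu : ∀ l : R, addVal B (t + algebraMap R B l * t') = p := fun l =>
    addVal_eq_of_sub_mem ht (by
      rw [add_sub_cancel_left]
      exact Ideal.mul_mem_left _ _ ht'.ge)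
  let S (l : R) : Subalgebra R B := overring _ p hp (hu l).ge
  have huS : ∀ l, t + algebraMap R B l * t' ∈ S l := fun l => ⟨0, 1, by simp⟩
  obtain ⟨lift, hlift⟩ := (residue_surjective (R := R)).hasRightInverse
  refine Set.infinite_of_injective_forall_mem
    (f := fun x => dualIdeal (Subalgebra.toSubmodule (S (lift x)))) (fun x y hxy => ?_)
    fun x => isTraceIdeal_dualIdeal _
  by_contra hne
  -- The two overrings need not be nested, so duality is applied to one of them inside their sum,
  -- which has the same dual.
  have hle : Subalgebra.toSubmodule (S (lift x)) ⊔ Subalgebra.toSubmodule (S (lift y)) ≤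
      Subalgebra.toSubmodule (S (lift x)) :=
    le_of_dualIdeal_le_of_containsValIdeal hdim hGor hc (S (lift x)).one_mem le_sup_left
      (le_trans (le_inf le_rfl hxy.le) (inf_dualIdeal_le _ _))
  have hy : t + algebraMap R B (lift y) * t' ∈ S (lift x) :=
    hle (Submodule.mem_sup_right (huS (lift y)))
  refine addVal_ne_of_mem_overring hp (hu (lift x)) hpH hpH'
    (sub_mem (huS (lift x)) hy) ?_
  have hunit : IsUnit (lift x - lift y) := by
    rw [← residue_ne_zero_iff_isUnit, map_sub, hlift, hlift]
    exact sub_ne_zero.2 hne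
  have : t + algebraMap R B (lift x) * t' - (t + algebraMap R B (lift y) * t') =
      algebraMap R B (lift x - lift y) * t' := by
    rw [map_sub]
    ring
  rw [this, addVal_mul, ht', addVal_eq_zero_iff.2 (hunit.map (algebraMap R B)), zero_add]

end Overrings

end TraceIdeals

namespace TraceIdeals

/-! ### Numerical semigroups. -/

section Semigroup

theorem mem_closure_two_iff {a p : ℕ} (ha : Odd a) :
    p ∈ AddSubmonoid.closure {2, a} ↔ Even p ∨ a ≤ p := by
  rw [AddSubmonoid.mem_closure_pair]
  constructor
  · rintro ⟨m, n, rfl⟩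
    rcases n with _ | n
    · exact Or.inl (by simp)
    · refine Or.inr ?_
      rw [smul_eq_mul, smul_eq_mul]
      nlinarith
  · intro h
    by_cases hp : Even p
    · obtain ⟨k, rfl⟩ := hp
      exact ⟨k, 0, by rw [smul_eq_mul, zero_smul]; omega⟩
    · obtain ⟨k, rfl⟩ := Nat.not_even_iff_odd.1 hp
      obtain ⟨l, rfl⟩ := ha
      have h := h.resolve_left hp
      exact ⟨k - l, 1, by rw [smul_eq_mul, one_smul]; omega⟩

theorem mem_closure_three_four_iff {p : ℕ} :
    p ∈ AddSubmonoid.closure {3, 4} ↔ p ≠ 1 ∧ p ≠ 2 ∧ p ≠ 5 := by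
  rw [AddSubmonoid.mem_closure_pair]
  simp only [smul_eq_mul]
  constructor
  · rintro ⟨m, n, rfl⟩
    omega
  · intro h
    have : p % 3 < 3 := Nat.mod_lt _ (by norm_num)
    exact ⟨(p - 4 * (p % 3)) / 3, p % 3, by omega⟩

theorem mem_closure_three_five_iff {p : ℕ} :
    p ∈ AddSubmonoid.closure {3, 5} ↔ p ≠ 1 ∧ p ≠ 2 ∧ p ≠ 4 ∧ p ≠ 7 := by
  rw [AddSubmonoid.mem_closure_pair]
  simp only [smul_eq_mul]
  constructor
  · rintro ⟨m, n, rfl⟩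
    omega
  · intro h
    obtain h0 | h1 | h2 : p % 3 = 0 ∨ p % 3 = 1 ∨ p % 3 = 2 := by omega
    · exact ⟨p / 3, 0, by omega⟩
    · exact ⟨(p - 10) / 3, 2, by omega⟩
    · exact ⟨(p - 5) / 3, 1, by omega⟩

/-- The value semigroups of the classification: a conductor bound `c` such that below `c`, for each
`m ∈ H`, at most one element of `H ∩ [m, ∞)` lies outside `m + H`. -/
theorem exists_bound_of_classification {H : AddSubmonoid ℕ}
    (hH : H = AddSubmonoid.closure {1} ∨
      (∃ a : ℕ, 2 < a ∧ Odd a ∧ H = AddSubmonoid.closure {2, a}) ∨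
      H = AddSubmonoid.closure {3, 4} ∨ H = AddSubmonoid.closure {3, 5}) :
    ∃ c : ℕ, (∀ n, c ≤ n → n ∈ H) ∧ ∀ m ∈ H, ∀ p ∈ H, ∀ q ∈ H,
      m ≤ p → p < c → m ≤ q → q < c → (∀ h ∈ H, p ≠ m + h) → (∀ h ∈ H, q ≠ m + h) → p = q := by
  rcases hH with rfl | ⟨a, -, ha, rfl⟩ | rfl | rfl
  · exact ⟨0, fun n _ => AddSubmonoid.mem_closure_singleton.2 ⟨n, by simp⟩, by omega⟩
  · simp only [mem_closure_two_iff ha]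
    -- The bound is the conductor `a - 1`; below it `H` has only even elements, so nothing is
    -- missed. The bounds `6` and `8` below are likewise the conductors.
    refine ⟨a - 1, fun n hn => ?_, fun m hm p hp q _ hmp hpc _ _ hpm _ => ?_⟩
    · rcases hn.eq_or_lt with rfl | hn
      · exact Or.inl (Nat.Odd.sub_odd ha odd_one)
      · exact Or.inr (by omega)
    · have hp : Even p := hp.resolve_right (by omega)
      have hm : Even m := hm.resolve_right (by omega)
      exact absurd (by omega) (hpm (p - m) (Or.inl (hp.tsub hm)))
  · simp only [mem_closure_three_four_iff]
    refine ⟨6, fun n hn => by omega, fun m hm p hp q hq hmp hpc hmq hqc hpm hqm => ?_⟩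
    have h1 := hpm (p - m)
    have h2 := hqm (q - m)
    omega
  · simp only [mem_closure_three_five_iff]
    refine ⟨8, fun n hn => by omega, fun m hm p hp q hq hmp hpc hmq hqc hpm hqm => ?_⟩
    have h1 := hpm (p - m)
    have h2 := hqm (q - m)
    omega

theorem add_mul_mem {H : AddSubmonoid ℕ} {e r : ℕ} (he : e ∈ H) (hr : r ∈ H) (k : ℕ) :
    r + k * e ∈ H := by
  simpa using H.add_mem hr (H.nsmul_mem he k)

/-- A numerical semigroup without consecutive gaps `p, p + 1`, `p ≥ 2`, that satisfies half of the
symmetry condition belongs to the classification. -/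
theorem classification_of_gaps {H : AddSubmonoid ℕ} {c : ℕ} (hc : ∀ n, c ≤ n → n ∈ H)
    (hgap : ∀ p, 2 ≤ p → p ∉ H → p + 1 ∈ H)
    (hsym : ∀ g h, (∀ n, g + h + 1 ≤ n → n ∈ H) → g + h ∉ H → g ∉ H → h ∈ H) :
    H = AddSubmonoid.closure {1} ∨
      (∃ a : ℕ, 2 < a ∧ Odd a ∧ H = AddSubmonoid.closure {2, a}) ∨
      H = AddSubmonoid.closure {3, 4} ∨ H = AddSubmonoid.closure {3, 5} := by
  classical
  by_cases h1 : 1 ∈ H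
  · left
    ext n
    exact ⟨fun _ => AddSubmonoid.mem_closure_singleton.2 ⟨n, by simp⟩,
      fun _ => by simpa using H.nsmul_mem h1 n⟩
  right
  by_cases h2 : 2 ∈ H
  · left
    have hex : ∃ a, Odd a ∧ a ∈ H := ⟨2 * c + 1, ⟨c, rfl⟩, hc _ (by omega)⟩
    obtain ⟨hodd, hmem⟩ := Nat.find_spec hex
    refine ⟨Nat.find hex, ?_, hodd, ?_⟩
    · have hne : Nat.find hex ≠ 1 := fun h => h1 (h ▸ hmem)
      obtain ⟨k, hk⟩ := hodd
      omega
    · ext n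
      rw [mem_closure_two_iff hodd]
      constructor
      · intro hn
        by_cases he : Even n
        · exact Or.inl he
        · exact Or.inr (Nat.find_min' hex ⟨Nat.not_even_iff_odd.1 he, hn⟩)
      · intro h
        by_cases he : Even n
        · obtain ⟨k, rfl⟩ := he
          have := H.nsmul_mem h2 k
          rwa [smul_eq_mul, mul_two] at this
        · obtain ⟨k, rfl⟩ := Nat.not_even_iff_odd.1 he
          have hle := h.resolve_left he
          obtain ⟨l, hl⟩ := hodd
          have := add_mul_mem h2 hmem (k - l)
          rwa [show Nat.find hex + (k - l) * 2 = 2 * k + 1 by omega] at this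
  right
  have h3 : 3 ∈ H := hgap 2 le_rfl h2
  by_cases h4 : 4 ∈ H
  · left
    -- With `3, 4, 5 ∈ H` the largest gap would be `2 = 1 + 1`, and symmetry would give `1 ∈ H`. The
    -- gap `7` below is similar, with `4 = 2 + 2`.
    have h5 : 5 ∉ H := fun h5 => h1 (hsym 1 1 (fun n hn => by
      obtain ⟨k, hk | hk | hk⟩ : ∃ k, n = 3 + k * 3 ∨ n = 4 + k * 3 ∨ n = 5 + k * 3 :=
        ⟨(n - 3) / 3, by omega⟩
      all_goals rw [hk]; exact add_mul_mem h3 ‹_› k) h2 h1)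
    ext n
    refine ⟨fun hn => mem_closure_three_four_iff.2
      ⟨fun h => h1 (h ▸ hn), fun h => h2 (h ▸ hn), fun h => h5 (h ▸ hn)⟩, fun hn => ?_⟩
    exact (AddSubmonoid.closure_le (S := H)).2 (by rintro x (rfl | rfl) <;> assumption) hn
  · right
    have h5 : 5 ∈ H := hgap 4 (by norm_num) h4
    have h6 : 6 ∈ H := H.add_mem h3 h3
    have h7 : 7 ∉ H := fun h7 => h2 (hsym 2 2 (fun n hn => by
      obtain ⟨k, hk | hk | hk⟩ : ∃ k, n = 5 + k * 3 ∨ n = 6 + k * 3 ∨ n = 7 + k * 3 :=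
        ⟨(n - 5) / 3, by omega⟩
      all_goals rw [hk]; exact add_mul_mem h3 ‹_› k) h4 h2)
    ext n
    refine ⟨fun hn => mem_closure_three_five_iff.2
      ⟨fun h => h1 (h ▸ hn), fun h => h2 (h ▸ hn), fun h => h4 (h ▸ hn), fun h => h7 (h ▸ hn)⟩,
      fun hn => ?_⟩
    exact (AddSubmonoid.closure_le (S := H)).2 (by rintro x (rfl | rfl) <;> assumption) hn

end Semigroup

/-! ### Residue lifts and a conductor bound for the integral closure. -/

section IntegralClosure

open IsLocalRing IsDiscreteValuationRing

variable {R : Type*} [CommRing R] {K : Type*} [Field K] [Algebra R K]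

theorem hasResidueLifts_of_surjective [IsLocalRing R] {B : Type*} [CommRing B] [IsDomain B]
    [IsDiscreteValuationRing B] [Algebra R B] [IsLocalHom (algebraMap R B)]
    (hres : Function.Surjective (ResidueField.map (algebraMap R B))) : HasResidueLifts R B := by
  intro b
  obtain ⟨x, hx⟩ := hres (residue B b)
  obtain ⟨r, rfl⟩ := residue_surjective x
  refine ⟨r, ?_⟩
  rw [ResidueField.map_residue, eq_comm, ← sub_eq_zero, ← map_sub, residue_eq_zero_iff,
    mem_maximalIdeal, mem_nonunits_iff, ← addVal_eq_zero_iff] at hx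
  rw [mem_valIdeal, Nat.cast_one]
  exact Order.one_le_iff_pos.2 (pos_iff_ne_zero.2 hx)

/-- A common denominator `d` of finitely many module generators multiplies the integral closure into
`R`; its value is the bound. -/
theorem exists_containsValIdeal [IsDomain R] [IsFractionRing R K]
    [IsDiscreteValuationRing (integralClosure R K)] [Module.Finite R (integralClosure R K)] :
    ∃ c, ContainsValIdeal R (integralClosure R K) c := by
  classical
  obtain ⟨s, hs⟩ := Module.Finite.fg_top (R := R) (M := integralClosure R K)
  obtain ⟨d, hd⟩ := IsLocalization.exist_integer_multiples_of_finset (nonZeroDivisors R)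
    (s.image fun b : integralClosure R K => (b : K))
  have hmul : ∀ b : integralClosure R K, ∃ r : R, algebraMap R K r = algebraMap R K d * b := by
    intro b
    have hb : b ∈ Submodule.span R (s : Set (integralClosure R K)) := hs ▸ Submodule.mem_top
    induction hb using Submodule.span_induction with
    | mem x hx =>
      obtain ⟨r, hr⟩ := hd x (Finset.mem_image_of_mem _ hx)
      exact ⟨r, by rw [hr, Algebra.smul_def]⟩
    | zero => exact ⟨0, by simp⟩
    | add x y _ _ hx hy =>
      obtain ⟨r, hr⟩ := hx
      obtain ⟨t, ht⟩ := hy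
      exact ⟨r + t, by rw [map_add, hr, ht, ← mul_add]; rfl⟩
    | smul a x _ hx =>
      obtain ⟨r, hr⟩ := hx
      refine ⟨a * r, ?_⟩
      rw [map_mul, hr, mul_left_comm, ← Algebra.smul_def a (x : K)]
      rfl
  have hd0 : algebraMap R (integralClosure R K) d ≠ 0 := fun h =>
    nonZeroDivisors.coe_ne_zero d (IsFractionRing.injective R K
      (by rw [map_zero]; exact congrArg Subtype.val h))
  obtain ⟨c, hc⟩ := exists_addVal_eq_natCast hd0
  refine ⟨c, fun b hb => ?_⟩
  obtain ⟨w, rfl⟩ := addVal_le_iff_dvd.1 (hc.le.trans hb)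
  obtain ⟨r, hr⟩ := hmul w
  exact ⟨r, Subtype.ext hr⟩

end IntegralClosure

end TraceIdeals

theorem mainTheorem1 {R : Type*} [CommRing R] [IsDomain R] [IsNoetherianRing R] [IsLocalRing R]
    {K : Type*} [Field K] [Algebra R K] [IsFractionRing R K]
    (hdim : ringKrullDim R = 1)
    [IsDiscreteValuationRing (integralClosure R K)]
    [Module.Finite R (integralClosure R K)]
    (hres : Function.Bijective
      (IsLocalRing.ResidueField.map (algebraMap R (integralClosure R K))))
    [Infinite (IsLocalRing.ResidueField R)]
    (hGor : TraceIdeals.IsGorensteinLocalRing R)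
    (H : AddSubmonoid ℕ) (hH : H = TraceIdeals.valueSemigroup R (integralClosure R K)) :
    List.TFAE [
      {I : Ideal R | TraceIdeals.IsTraceIdeal I}.Finite,
      H = AddSubmonoid.closure {1} ∨
        (∃ a : ℕ, 2 < a ∧ Odd a ∧ H = AddSubmonoid.closure {2, a}) ∨
        H = AddSubmonoid.closure {3, 4} ∨ H = AddSubmonoid.closure {3, 5},
      ∀ I : Ideal R, TraceIdeals.IsTraceIdeal I → TraceIdeals.IsIntegrallyClosedIdeal I] := by
  open TraceIdeals in
  have : FaithfulSMul R (integralClosure R K) :=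
    (faithfulSMul_iff_algebraMap_injective R _).2 fun a b h =>
      IsFractionRing.injective R K (congrArg Subtype.val h)
  have hlift := hasResidueLifts_of_surjective hres.2
  obtain ⟨C, hC⟩ := exists_containsValIdeal (R := R) (K := K)
  subst hH
  tfae_have 1 → 2 := fun hfin => by
    refine classification_of_gaps (c := C) (fun n hn => ?_) (fun p hp hpH => ?_)
      fun g h hc => mem_valueSemigroup_of_isGorenstein hdim hGor
        (hC.of_mem_valueSemigroup hlift hc)
    · obtain ⟨b, hb⟩ := exists_addVal_eq (B := integralClosure R K) n
      obtain ⟨r, rfl⟩ := hC b (valIdeal_anti hn hb.ge)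
      exact mem_valueSemigroup.2 ⟨r, hb⟩
    · by_contra hpH'
      exact infinite_isTraceIdeal hdim hGor hC hp hpH hpH' hfin
  tfae_have 2 → 3 := fun hcl I hI => by
    obtain ⟨c, hc, hcH⟩ := exists_bound_of_classification hcl
    exact hI.isIntegrallyClosedIdeal hlift (hC.of_mem_valueSemigroup hlift hc) hcH
  tfae_have 3 → 1 := finite_isTraceIdeal_of_isIntegrallyClosedIdeal hC
  tfae_finish
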